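/- Let $n,d\ge 0$ be integers, let $\lambda=(\lambda_1\ge\dots\ge\lambda_n)$ be a partition of $d$ into $n$ non-negative parts, and let $\mu=(\mu_1,\dots,\mu_n)$ be a sequence of non-negative integers with sum $d$. Let $\mu^+$ be the partition obtained by rearranging the parts of $\mu$ in weakly decreasing order, and let $x^\lambda$ be a nilpotent endomorphism of $\mathbb{C}^d$ whose Jordan type (the partition formed by its Jordan block sizes) is the transpose $\lambda^T$ of $\lambda$. Let $X^\lambda_\mu$ be the Spaltenstein variety of all partial flags $$\{0\}=V_0\le V_1\le\dots\le V_n=\mathbb{C}^d,\qquad \dim V_i/V_{i-1}=\mu_i,\qquad x^\lambda V_i\subseteq V_{i-1}\quad (1\le i\le n),$$ with its classical (complex analytic) topology as a subspace of the partial flag variety. Then $X^\lambda_\mu$ is non-empty if and only if $\lambda$ dominates $\mu^+$, that is, $\lambda_1+\dots+\lambda_k\ge\mu^+_1+\dots+\mu^+_k$ for all $1\le k\le n$. In that case $X^\lambda_\mu$ is connected. -/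

import Mathlib

namespace Spaltenstein

/-- The dominance order on `n`-part partitions of the same size:
`ν_1 + ⋯ + ν_k ≤ lam_1 + ⋯ + lam_k` for every `k`. -/
def Dominates {n : ℕ} (lam ν : Fin n → ℕ) : Prop :=
  ∀ k : Fin n, ∑ i ∈ Finset.Iic k, ν i ≤ ∑ i ∈ Finset.Iic k, lam i

/-- The rearrangement `μ⁺` of the parts of `μ` in weakly decreasing order
(`Tuple.sort` sorts increasingly, `Fin.rev` reverses). -/
def sortDesc {n : ℕ} (μ : Fin n → ℕ) : Fin n → ℕ :=
  fun i => μ (Tuple.sort μ i.rev)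

/-- The Young diagram whose `i`-th row has `lam i` boxes; rows of length `0` are invisible. -/
def youngDiagram {n : ℕ} (lam : Fin n → ℕ) (hlam : Antitone lam) : YoungDiagram :=
  YoungDiagram.ofRowLens (List.ofFn lam) hlam.sortedGE_ofFn

/-- The endomorphism `x` is nilpotent of Jordan type `ν`: there is a basis indexed by the boxes of
`ν` in which every row of `ν` is a Jordan chain for the eigenvalue `0`, that is, `x` moves each
basis vector one box to the left and kills the first box of each row. -/
def HasJordanType {E : Type*} [AddCommGroup E] [Module ℂ E] (x : Module.End ℂ E)
    (ν : YoungDiagram) : Prop :=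
  ∃ b : Module.Basis ν.cells ℂ E,
    (∀ c : ν.cells, c.1.2 = 0 → x (b c) = 0) ∧
    (∀ c c' : ν.cells, c'.1.1 = c.1.1 → c.1.2 = c'.1.2 + 1 → x (b c) = b c')

/-- The partial flags `{0} = V_0 ≤ V_1 ≤ ⋯ ≤ V_n = ℂ^d` of type `μ`, i.e. with
`dim V_i / V_{i-1} = μ_i`. -/
@[ext]
structure PartialFlag (d : ℕ) {n : ℕ} (μ : Fin n → ℕ) where
  V : Fin (n + 1) → Submodule ℂ (EuclideanSpace ℂ (Fin d))
  zero : V 0 = ⊥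
  last : V (Fin.last n) = ⊤
  le_succ : ∀ i : Fin n, V i.castSucc ≤ V i.succ
  finrank_quotient : ∀ i : Fin n,
    Module.finrank ℂ (V i.succ ⧸ (V i.castSucc).submoduleOf (V i.succ)) = μ i

/-- The classical (complex analytic) topology of the partial flag variety. It is the subspace
topology from a product of Grassmannians, each Grassmannian being embedded in the space of
(bounded) operators on `ℂ^d` by sending a subspace to the orthogonal projection onto it. -/
noncomputable instance PartialFlag.topologicalSpace {d n : ℕ} (μ : Fin n → ℕ) : TopologicalSpace (PartialFlag d μ) :=
  TopologicalSpace.induced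
    (fun F (i : Fin (n + 1)) => (F.V i).starProjection) inferInstance

/-- The variety of partial flags of type `μ` with `x V_i ⊆ V_{i-1}` for all `i`. -/
def spaltensteinVariety {d n : ℕ} (x : Module.End ℂ (EuclideanSpace ℂ (Fin d)))
    (μ : Fin n → ℕ) : Set (PartialFlag d μ) :=
  {F | ∀ i : Fin n, (F.V i.succ).map x ≤ F.V i.castSucc}

end Spaltenstein

/-! Call `μ` admissible for an `x`-stable `H` if every partial sum of `μ` over a set of `k` indices
is at most `dim (ker x^k ⊓ H)`. When `H` is the whole space, counting Jordan boxes turns this into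
dominance of `μ⁺` by `λ`. For general `H`, `isConnected_flags` shows by induction on `n` that
admissibility makes the space of flags non-empty and connected.

The induction forgets all of the flag but its last proper step `V`. The fibres are flag spaces for
`V`, connected by induction; the image consists of the `V` between `xH` and `H` of the right
dimension for which the shortened `μ` is admissible. Since `V` contains `xH`, the modular law
rewrites these conditions as Schubert conditions relative to the chain `ker x^k ⊓ H ⊔ xH`. Such a
locus is path connected once it contains a `V₀` comparable with every member of the chain
(`joinedIn_schubert`), and admissibility of `μ` supplies one. Compactness then gives connectedness
of the total space (`isPreconnected_of_fibers`). -/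

namespace Spaltenstein

open Module Set Topology

section Span

variable {E : Type*} [AddCommGroup E] [Module ℂ E] [FiniteDimensional ℂ E]

theorem finrank_sup_span_singleton {W : Submodule ℂ E} {z : E} (hz : z ∉ W) :
    finrank ℂ (W ⊔ ℂ ∙ z : Submodule ℂ E) = finrank ℂ W + 1 := by
  have h := Submodule.finrank_sup_add_finrank_inf_eq W (ℂ ∙ z)
  have h0 : z ≠ 0 := fun h => hz (h ▸ W.zero_mem)
  have : W ⊓ ℂ ∙ z = ⊥ := (Submodule.disjoint_span_singleton' h0 |>.2 hz).eq_bot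
  rw [this, finrank_bot, finrank_span_singleton h0] at h
  simpa using h

end Span

/-! ### Topology of the Grassmannian via orthogonal projections. -/

section Grassmannian

variable {E : Type*} [NormedAddCommGroup E] [InnerProductSpace ℂ E] [FiniteDimensional ℂ E]

/-- The topology on the set of subspaces of a finite-dimensional inner product space which is
induced by sending a subspace to the orthogonal projection onto it. -/
noncomputable instance grassmannianTopology : TopologicalSpace (Submodule ℂ E) :=
  TopologicalSpace.induced (fun V => V.starProjection) inferInstance

theorem isInducing_starProjection :
    IsInducing (fun V : Submodule ℂ E => V.starProjection) := ⟨rfl⟩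

theorem continuous_starProjection :
    Continuous (fun V : Submodule ℂ E => V.starProjection) :=
  isInducing_starProjection.continuous

theorem isEmbedding_starProjection :
    IsEmbedding (fun V : Submodule ℂ E => V.starProjection) :=
  ⟨isInducing_starProjection, fun _ _ h => Submodule.starProjection_inj.1 h⟩

instance : T2Space (Submodule ℂ E) := isEmbedding_starProjection.t2Space

theorem range_starProjection_eq :
    range (fun V : Submodule ℂ E => V.starProjection) = {p | p * p = p ∧ star p = p} := by
  ext p
  constructor
  · rintro ⟨V, rfl⟩
    have h : IsStarProjection V.starProjection := isStarProjection_starProjection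
    exact ⟨h.isIdempotentElem, h.isSelfAdjoint⟩
  · rintro ⟨h1, h2⟩
    have h : IsStarProjection p := ⟨h1, h2⟩
    obtain ⟨_, hK⟩ := isStarProjection_iff_eq_starProjection_range.1 h
    exact ⟨_, hK.symm⟩

/-- The self-adjoint idempotents form a closed bounded set in a finite-dimensional space of
operators. -/
instance : CompactSpace (Submodule ℂ E) := by
  rw [← isCompact_univ_iff, isInducing_starProjection.isCompact_iff, image_univ]
  have : ProperSpace (E →L[ℂ] E) := FiniteDimensional.proper ℂ _
  apply Metric.isCompact_of_isClosed_isBounded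
  · rw [range_starProjection_eq]
    exact (isClosed_eq (by fun_prop) continuous_id).inter (isClosed_eq (by fun_prop) continuous_id)
  · rw [isBounded_iff_forall_norm_le]
    exact ⟨1, by rintro _ ⟨V, rfl⟩; exact V.starProjection_norm_le⟩

variable {X : Type*} [TopologicalSpace X]

theorem isClosed_setOf_mem {f : X → E} {V : X → Submodule ℂ E} (hf : Continuous f)
    (hV : Continuous V) : IsClosed {a | f a ∈ V a} := by
  have : {a | f a ∈ V a} = {a | (V a).starProjection (f a) = f a} := by
    ext a; simp only [mem_ofPred_eq, Submodule.starProjection_eq_self_iff]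
  rw [this]
  exact isClosed_eq ((continuous_starProjection.comp hV).clm_apply hf) hf

theorem isClosed_setOf_map_le (x : Module.End ℂ E) {V W : X → Submodule ℂ E}
    (hV : Continuous V) (hW : Continuous W) : IsClosed {a | (V a).map x ≤ W a} := by
  have : {a | (V a).map x ≤ W a} = ⋂ v : E, {a | x ((V a).starProjection v) ∈ W a} := by
    ext a
    simp only [mem_ofPred_eq, mem_iInter, Submodule.map_le_iff_le_comap]
    constructor
    · intro h v
      exact h (Submodule.starProjection_apply_mem _ v)
    · intro h v hv
      simpa [Submodule.starProjection_eq_self_iff.2 hv] using h v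
  rw [this]
  exact isClosed_iInter fun v => isClosed_setOf_mem
    (x.continuous_of_finiteDimensional.comp
      ((continuous_starProjection.comp hV).clm_apply continuous_const)) hW

theorem isClosed_setOf_le {V W : X → Submodule ℂ E} (hV : Continuous V) (hW : Continuous W) :
    IsClosed {a | V a ≤ W a} := by
  simpa using isClosed_setOf_map_le LinearMap.id hV hW

/-- The dimension is the trace of the projection. -/
theorem continuous_finrank : Continuous fun V : Submodule ℂ E => (finrank ℂ V : ℂ) := by
  have : (fun V : Submodule ℂ E => (finrank ℂ V : ℂ)) =
      fun V => LinearMap.trace ℂ E (V.starProjection : E →ₗ[ℂ] E) := by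
    ext V
    refine (LinearMap.IsProj.trace (p := V) ⟨fun v => ?_, fun v hv => ?_⟩).symm
    · exact Submodule.starProjection_apply_mem _ v
    · exact Submodule.starProjection_eq_self_iff.2 hv
  rw [this]
  exact ((LinearMap.trace ℂ E ∘ₗ ContinuousLinearMap.coeLM ℂ).continuous_of_finiteDimensional).comp
    continuous_starProjection

theorem isClosed_setOf_finrank_eq {V W : X → Submodule ℂ E} (hV : Continuous V)
    (hW : Continuous W) (m : ℕ) : IsClosed {a | finrank ℂ (V a) = finrank ℂ (W a) + m} := by
  have : {a | finrank ℂ (V a) = finrank ℂ (W a) + m} =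
      {a | (finrank ℂ (V a) : ℂ) = finrank ℂ (W a) + m} := by
    ext a; simp only [mem_ofPred_eq]; norm_cast
  rw [this]
  exact isClosed_eq (continuous_finrank.comp hV)
    ((continuous_finrank.comp hW).add continuous_const)

/-- A map to a compact space with closed graph is continuous. The graph is closed because the value
at `a` is the only subspace of dimension `dim W + 1` containing both `W` and `z a`. -/
theorem continuous_sup_span_singleton {W : Submodule ℂ E} {z : X → E} (hz : Continuous z)
    (hzW : ∀ a, z a ∉ W) : Continuous fun a => W ⊔ ℂ ∙ z a := by
  have hgraph : IsClosed {p : X × Submodule ℂ E | W ⊔ ℂ ∙ z p.1 = p.2} := by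
    have : {p : X × Submodule ℂ E | W ⊔ ℂ ∙ z p.1 = p.2} = {p | W ≤ p.2} ∩ {p | z p.1 ∈ p.2} ∩
        {p | finrank ℂ p.2 = finrank ℂ W + 1} := by
      ext ⟨a, V⟩
      simp only [mem_inter_iff, mem_ofPred_eq]
      constructor
      · rintro rfl
        exact ⟨⟨le_sup_left, Submodule.mem_sup_right (Submodule.mem_span_singleton_self _)⟩,
          finrank_sup_span_singleton (hzW a)⟩
      · rintro ⟨⟨h1, h2⟩, h3⟩
        refine Submodule.eq_of_le_of_finrank_eq (sup_le h1 (by simpa using h2)) ?_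
        rw [h3, finrank_sup_span_singleton (hzW a)]
    rw [this]
    exact ((isClosed_setOf_le continuous_const continuous_snd).inter
      (isClosed_setOf_mem (hz.comp continuous_fst) continuous_snd)).inter
      (isClosed_setOf_finrank_eq continuous_snd continuous_const 1)
  rw [continuous_iff_isClosed]
  intro C hC
  have : (fun a => W ⊔ ℂ ∙ z a) ⁻¹' C =
      Prod.fst '' ({p : X × Submodule ℂ E | W ⊔ ℂ ∙ z p.1 = p.2} ∩ Prod.snd ⁻¹' C) := by
    ext a
    constructor
    · exact fun h => ⟨(a, _), ⟨by simp, h⟩, rfl⟩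
    · rintro ⟨⟨b, V⟩, ⟨hb, hV⟩, rfl⟩
      rw [mem_ofPred_eq] at hb
      exact mem_preimage.2 (hb ▸ hV)
  rw [this]
  exact isClosedMap_fst_of_compactSpace _ (hgraph.inter (hC.preimage continuous_snd))

end Grassmannian

/-- A compact set is preconnected if it maps onto a preconnected set with preconnected fibres. -/
theorem isPreconnected_of_fibers {X Y : Type*} [TopologicalSpace X] [TopologicalSpace Y] [T2Space Y]
    {f : X → Y} (hf : Continuous f) {s : Set X} (hs : IsCompact s) (hfs : IsPreconnected (f '' s))
    (hfib : ∀ y ∈ f '' s, IsPreconnected (s ∩ f ⁻¹' {y})) : IsPreconnected s := by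
  rw [isPreconnected_closed_iff]
  rintro A B hA hB hAB ⟨a, has, haA⟩ ⟨b, hbs, hbB⟩
  -- By compactness both pieces have closed images, so these meet at some `y`; the fibre over `y`
  -- then meets both pieces.
  obtain ⟨y, hy, ⟨a', ha', rfl⟩, ⟨b', hb', hb'y⟩⟩ := isPreconnected_closed_iff.1 hfs
    (f '' (s ∩ A)) (f '' (s ∩ B))
    ((hs.inter_right hA).image hf).isClosed ((hs.inter_right hB).image hf).isClosed
    (by
      rintro _ ⟨c, hc, rfl⟩
      exact (hAB hc).imp (fun h => ⟨c, ⟨hc, h⟩, rfl⟩) (fun h => ⟨c, ⟨hc, h⟩, rfl⟩))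
    ⟨f a, ⟨a, has, rfl⟩, ⟨a, ⟨has, haA⟩, rfl⟩⟩ ⟨f b, ⟨b, hbs, rfl⟩, ⟨b, ⟨hbs, hbB⟩, rfl⟩⟩
  obtain ⟨c, hc, hcAB⟩ := isPreconnected_closed_iff.1 (hfib _ hy) A B hA hB
    (inter_subset_left.trans hAB) ⟨a', ⟨ha'.1, rfl⟩, ha'.2⟩ ⟨b', ⟨hb'.1, hb'y⟩, hb'.2⟩
  exact ⟨c, hc.1, hcAB⟩

/-! ### Dimension counts for subspaces and kernels of powers. -/

section LinearAlgebra

variable {E : Type*} [AddCommGroup E] [Module ℂ E]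

theorem map_ker_pow_succ_inf {x : Module.End ℂ E} {H : Submodule ℂ E} (k : ℕ)
    (hH : H.map x ≤ H) :
    (LinearMap.ker (x ^ (k + 1)) ⊓ H).map x = LinearMap.ker (x ^ k) ⊓ H ⊓ H.map x := by
  ext v
  simp only [Submodule.mem_map, Submodule.mem_inf, LinearMap.mem_ker]
  constructor
  · rintro ⟨w, ⟨hw, hwH⟩, rfl⟩
    refine ⟨⟨?_, hH ⟨w, hwH, rfl⟩⟩, w, hwH, rfl⟩
    rw [pow_succ] at hw
    exact hw
  · rintro ⟨⟨hv, -⟩, w, hwH, rfl⟩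
    refine ⟨w, ⟨?_, hwH⟩, rfl⟩
    rw [pow_succ]
    exact hv

variable [FiniteDimensional ℂ E]

theorem exists_le_le_finrank_eq {A B : Submodule ℂ E} (hAB : A ≤ B) {m : ℕ}
    (hA : finrank ℂ A ≤ m) (hB : m ≤ finrank ℂ B) : ∃ V, A ≤ V ∧ V ≤ B ∧ finrank ℂ V = m := by
  induction m, hA using Nat.le_induction with
  | base => exact ⟨A, le_rfl, hAB, rfl⟩
  | succ m _ ih =>
    obtain ⟨V, hAV, hVB, hV⟩ := ih (by omega)
    obtain ⟨z, hzB, hzV⟩ : ∃ z ∈ B, z ∉ V := by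
      by_contra! h
      have := Submodule.finrank_mono (show B ≤ V from h)
      omega
    refine ⟨V ⊔ ℂ ∙ z, hAV.trans le_sup_left, sup_le hVB (by simpa using hzB), ?_⟩
    rw [finrank_sup_span_singleton hzV, hV]

/-- In a chain of subspaces, every dimension in between is attained by a subspace which is
comparable with all members of the chain. -/
theorem exists_finrank_eq_comparable {G : ℕ → Submodule ℂ E} (hG : Monotone G) {m K : ℕ}
    (h0 : finrank ℂ (G 0) ≤ m) (hK : m ≤ finrank ℂ (G K)) :
    ∃ V, G 0 ≤ V ∧ V ≤ G K ∧ finrank ℂ V = m ∧ ∀ k, G k ≤ V ∨ V ≤ G k := by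
  induction K with
  | zero => exact ⟨G 0, le_rfl, le_rfl, le_antisymm h0 hK, fun k => Or.inr (hG (Nat.zero_le k))⟩
  | succ K ih =>
    rcases le_total m (finrank ℂ (G K)) with h | h
    · obtain ⟨V, h1, h2, h3⟩ := ih h
      exact ⟨V, h1, h2.trans (hG K.le_succ), h3⟩
    · obtain ⟨V, h1, h2, h3⟩ := exists_le_le_finrank_eq (hG K.le_succ) h hK
      refine ⟨V, (hG (Nat.zero_le K)).trans h1, h2, h3, fun k => ?_⟩
      rcases le_or_gt k K with hk | hk
      · exact Or.inl ((hG hk).trans h1)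
      · exact Or.inr (h2.trans (hG hk))

theorem finrank_map_add_finrank_ker_inf (x : Module.End ℂ E) (S : Submodule ℂ E) :
    finrank ℂ (S.map x) + finrank ℂ (LinearMap.ker x ⊓ S : Submodule ℂ E) = finrank ℂ S := by
  have h := (x.domRestrict S).finrank_range_add_finrank_ker
  rw [LinearMap.range_domRestrict, LinearMap.ker_domRestrict] at h
  rw [← h, inf_comm]
  congr 1
  rw [(Submodule.equivMapOfInjective S.subtype S.injective_subtype _).finrank_eq,
    Submodule.map_comap_subtype]

theorem finrank_ker_pow_inf_inf_map {x : Module.End ℂ E} {H : Submodule ℂ E} (k : ℕ)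
    (hH : H.map x ≤ H) :
    finrank ℂ (LinearMap.ker (x ^ k) ⊓ H ⊓ H.map x : Submodule ℂ E) +
      finrank ℂ (LinearMap.ker x ⊓ H : Submodule ℂ E) =
      finrank ℂ (LinearMap.ker (x ^ (k + 1)) ⊓ H : Submodule ℂ E) := by
  rw [← map_ker_pow_succ_inf k hH,
    ← finrank_map_add_finrank_ker_inf x (LinearMap.ker (x ^ (k + 1)) ⊓ H), ← inf_assoc]
  have h : LinearMap.ker x ≤ LinearMap.ker (x ^ (k + 1)) := by
    rw [pow_succ]
    exact LinearMap.ker_le_ker_comp x (x ^ k)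
  rw [inf_eq_left.2 h]

/-- By the modular law `V ⊓ (F ⊔ L) = (V ⊓ F) ⊔ L`. Conditions on `V ⊓ F` can thus be traded for
conditions on `V ⊓ (F ⊔ L)`. -/
theorem finrank_inf_sup_add_finrank_inf {L V F : Submodule ℂ E} (hL : L ≤ V) :
    finrank ℂ (V ⊓ (F ⊔ L) : Submodule ℂ E) + finrank ℂ (F ⊓ L : Submodule ℂ E) =
      finrank ℂ (V ⊓ F : Submodule ℂ E) + finrank ℂ L := by
  have h := Submodule.finrank_sup_add_finrank_inf_eq (V ⊓ F) L
  rw [inf_sup_assoc_of_le F hL, inf_comm V F, inf_assoc, inf_eq_right.2 hL] at h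
  rw [h, inf_comm V F]

end LinearAlgebra

/-! ### Paths in Schubert loci. -/

section Paths

variable {E : Type*} [NormedAddCommGroup E] [InnerProductSpace ℂ E]

/-- The subspaces of dimension `m` between `L` and `H` satisfying Schubert conditions. -/
def schubert {ι : Type*} (L H : Submodule ℂ E) (m : ℕ) (G : ι → Submodule ℂ E) (a : ι → ℕ) :
    Set (Submodule ℂ E) :=
  {V | L ≤ V ∧ V ≤ H ∧ finrank ℂ V = m ∧ ∀ i, a i ≤ finrank ℂ (V ⊓ G i : Submodule ℂ E)}

theorem mem_schubert {ι : Type*} {L H : Submodule ℂ E} {m : ℕ} {G : ι → Submodule ℂ E}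
    {a : ι → ℕ} {V : Submodule ℂ E} : V ∈ schubert L H m G a ↔
      L ≤ V ∧ V ≤ H ∧ finrank ℂ V = m ∧ ∀ i, a i ≤ finrank ℂ (V ⊓ G i : Submodule ℂ E) :=
  Iff.rfl

variable [FiniteDimensional ℂ E]

/-- If `V ⊓ G` is not inside the hyperplane `W` of `V`, then `v` is congruent modulo `W` to some `y
∈ G`. The moving vector is then congruent to a vector of `G` outside `W`, which restores the one
dimension by which `W ⊓ G` may fall short. -/
theorem finrank_inf_le_finrank_sup_span_inf {W V G : Submodule ℂ E} {v u : E} {t : ℝ}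
    (hWV : W ≤ V) (hvV : v ∈ V) (hVW : finrank ℂ V = finrank ℂ W + 1)
    (hu : u ∈ G) (hz : (1 - t) • v + t • u ∉ W) :
    finrank ℂ (V ⊓ G : Submodule ℂ E) ≤
      finrank ℂ ((W ⊔ ℂ ∙ ((1 - t) • v + t • u)) ⊓ G : Submodule ℂ E) := by
  by_cases hVG : V ⊓ G ≤ W
  · exact Submodule.finrank_mono (le_inf (hVG.trans le_sup_left) inf_le_right)
  obtain ⟨v', ⟨hv'V, hv'G⟩, hv'W⟩ := SetLike.not_le_iff_exists.1 hVG
  have hV : W ⊔ ℂ ∙ v' = V := by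
    refine Submodule.eq_of_le_of_finrank_eq (sup_le hWV (by simpa using hv'V)) ?_
    rw [finrank_sup_span_singleton hv'W, hVW]
  obtain ⟨w, hw, y, hy, hwy⟩ := Submodule.mem_sup.1 (hV ▸ hvV : v ∈ W ⊔ ℂ ∙ v')
  have hyG : y ∈ G := (Submodule.span_singleton_le_iff_mem _ _).2 hv'G hy
  have hsmul : ∀ (S : Submodule ℂ E) (r : ℝ) (e : E), e ∈ S → r • e ∈ S := fun S r e he => by
    rw [← Complex.coe_smul]
    exact S.smul_mem _ he
  have hz' : (1 - t) • y + t • u = ((1 - t) • v + t • u) - (1 - t) • w := by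
    rw [← hwy, smul_add]; abel
  have hz'W : (1 - t) • y + t • u ∉ W := fun h => hz <| by
    rw [hz'] at h
    simpa using W.add_mem h (hsmul W (1 - t) w hw)
  have h1 : finrank ℂ (V ⊓ G : Submodule ℂ E) ≤ finrank ℂ (W ⊓ G : Submodule ℂ E) + 1 := by
    have h := Submodule.finrank_sup_add_finrank_inf_eq W (V ⊓ G)
    rw [← inf_assoc, inf_eq_left.2 hWV] at h
    have := Submodule.finrank_mono (sup_le hWV (inf_le_left : V ⊓ G ≤ V))
    omega
  refine h1.trans ?_
  rw [← finrank_sup_span_singleton (W := W ⊓ G) (fun h => hz'W h.1)]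
  refine Submodule.finrank_mono (sup_le (inf_le_inf_right _ le_sup_left) ?_)
  rw [Submodule.span_singleton_le_iff_mem]
  refine ⟨?_, G.add_mem (hsmul G _ y hyG) (hsmul G _ u hu)⟩
  rw [hz']
  exact Submodule.sub_mem _ (Submodule.mem_sup_right (Submodule.mem_span_singleton_self _))
    (Submodule.mem_sup_left (hsmul W _ w hw))

/-- Fix a hyperplane `W` of `V` containing `V ⊓ V₀` and rotate the remaining direction from `v ∈ V`
to `u ∈ V₀` outside `V`. This enlarges the intersection with `V₀`, so finitely many such moves reach
`V₀`. -/
theorem joinedIn_schubert {ι : Type*} {L H : Submodule ℂ E} {m : ℕ} {G : ι → Submodule ℂ E}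
    {a : ι → ℕ} {V₀ : Submodule ℂ E} (hL : L ≤ V₀) (hH : V₀ ≤ H) (hm : finrank ℂ V₀ = m)
    (hG : ∀ i, G i ≤ V₀ ∨ V₀ ≤ G i) {V : Submodule ℂ E} (hV : V ∈ schubert L H m G a) :
    JoinedIn (schubert L H m G a) V V₀ := by
  induction hk : m - finrank ℂ (V ⊓ V₀ : Submodule ℂ E) using Nat.strong_induction_on
    generalizing V with
  | _ k ih =>
  obtain ⟨hLV, hVH, hVm, hVa⟩ := mem_schubert.1 hV
  by_cases hle : V₀ ≤ V
  · rw [Submodule.eq_of_le_of_finrank_eq hle (hm.trans hVm.symm)] at *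
    exact JoinedIn.refl hV
  obtain ⟨u, hu₀, huV⟩ := SetLike.not_le_iff_exists.1 hle
  have hlt : finrank ℂ (V ⊓ V₀ : Submodule ℂ E) < m := by
    rw [← hm]
    exact Submodule.finrank_lt_finrank_of_lt (inf_lt_right.2 hle)
  obtain ⟨W, hVW, hWV, hW⟩ := exists_le_le_finrank_eq (inf_le_left : V ⊓ V₀ ≤ V)
    (m := m - 1) (by omega) (by omega)
  have hW1 : finrank ℂ V = finrank ℂ W + 1 := by omega
  obtain ⟨v, hvV, hvW⟩ : ∃ v ∈ V, v ∉ W := by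
    by_contra! h
    have := Submodule.finrank_mono (show V ≤ W from h)
    omega
  have hsmul : ∀ (S : Submodule ℂ E) (r : ℝ) (e : E), e ∈ S → r • e ∈ S := fun S r e he => by
    rw [← Complex.coe_smul]
    exact S.smul_mem _ he
  -- For `t ≠ 0`, membership in `W ≤ V` would force `u ∈ V`.
  have hz : ∀ t : ℝ, (1 - t) • v + t • u ∉ W := by
    intro t ht
    by_cases h0 : t = 0
    · subst h0
      exact hvW (by simpa using ht)
    · apply huV
      have h1 := V.sub_mem (hWV ht) (hsmul V (1 - t) v hvV)
      rw [add_sub_cancel_left] at h1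
      simpa [smul_smul, inv_mul_cancel₀ h0] using hsmul V t⁻¹ _ h1
  have hcont : Continuous fun t : ℝ => W ⊔ ℂ ∙ ((1 - t) • v + t • u) :=
    continuous_sup_span_singleton (by fun_prop) hz
  have hmem : ∀ t : ℝ, W ⊔ ℂ ∙ ((1 - t) • v + t • u) ∈ schubert L H m G a := by
    intro t
    refine mem_schubert.2 ⟨(le_inf hLV hL).trans (hVW.trans le_sup_left),
      sup_le (hWV.trans hVH) ?_, ?_, fun i => (hVa i).trans ?_⟩
    · rw [Submodule.span_singleton_le_iff_mem]
      exact H.add_mem (hsmul H _ _ (hVH hvV)) (hsmul H _ _ (hH hu₀))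
    · rw [finrank_sup_span_singleton (hz t)]
      omega
    -- If `G i ≤ V₀`, then `V ⊓ G i` lies in the fixed part `W`; if `V₀ ≤ G i`, then `u ∈ G i`.
    · rcases hG i with hi | hi
      · exact Submodule.finrank_mono (le_inf (((inf_le_inf_left V hi).trans hVW).trans le_sup_left)
          inf_le_right)
      · exact finrank_inf_le_finrank_sup_span_inf hWV hvV hW1 (hi hu₀) (hz t)
  have hV0 : W ⊔ ℂ ∙ v = V := by
    refine Submodule.eq_of_le_of_finrank_eq (sup_le hWV (by simpa using hvV)) ?_
    rw [finrank_sup_span_singleton hvW, hW1]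
  have hj : JoinedIn (schubert L H m G a) V (W ⊔ ℂ ∙ u) :=
    JoinedIn.ofLine hcont.continuousOn (by simpa using hV0) (by simp)
      (by rintro _ ⟨t, -, rfl⟩; exact hmem t)
  refine hj.trans (ih _ ?_ hj.target_mem rfl)
  have h1 : finrank ℂ (V ⊓ V₀ : Submodule ℂ E) + 1 ≤
      finrank ℂ ((W ⊔ ℂ ∙ u) ⊓ V₀ : Submodule ℂ E) := by
    rw [← finrank_sup_span_singleton (W := V ⊓ V₀) (fun h => huV h.1)]
    exact Submodule.finrank_mono (sup_le (le_inf (hVW.trans le_sup_left) inf_le_right)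
      (le_inf le_sup_right (by simpa using hu₀)))
  omega

theorem isConnected_schubert {ι : Type*} {L H : Submodule ℂ E} {m : ℕ} {G : ι → Submodule ℂ E}
    {a : ι → ℕ} {V₀ : Submodule ℂ E} (hV₀ : V₀ ∈ schubert L H m G a)
    (hG : ∀ i, G i ≤ V₀ ∨ V₀ ≤ G i) : IsConnected (schubert L H m G a) := by
  obtain ⟨hL, hH, hm, -⟩ := mem_schubert.1 hV₀
  exact IsPathConnected.isConnected ⟨V₀, hV₀, fun {V} hV => (joinedIn_schubert hL hH hm hG hV).symm⟩

end Paths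

/-! ### Flag spaces and the admissibility criterion. -/

section Flags

variable {E : Type*} [NormedAddCommGroup E] [InnerProductSpace ℂ E]

/-- The flags of type `μ` from `⊥` to `H` such that `x` maps each member to the preceding one. -/
def flags (x : Module.End ℂ E) (H : Submodule ℂ E) {n : ℕ} (μ : Fin n → ℕ) :
    Set (Fin (n + 1) → Submodule ℂ E) :=
  {V | V 0 = ⊥ ∧ V (Fin.last n) = H ∧ ∀ i : Fin n, V i.castSucc ≤ V i.succ ∧
    finrank ℂ (V i.succ) = finrank ℂ (V i.castSucc) + μ i ∧ (V i.succ).map x ≤ V i.castSucc}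

theorem mem_flags {x : Module.End ℂ E} {H : Submodule ℂ E} {n : ℕ} {μ : Fin n → ℕ}
    {V : Fin (n + 1) → Submodule ℂ E} : V ∈ flags x H μ ↔
      V 0 = ⊥ ∧ V (Fin.last n) = H ∧ ∀ i : Fin n, V i.castSucc ≤ V i.succ ∧
        finrank ℂ (V i.succ) = finrank ℂ (V i.castSucc) + μ i ∧ (V i.succ).map x ≤ V i.castSucc :=
  Iff.rfl

theorem snoc_mem_flags {x : Module.End ℂ E} {H : Submodule ℂ E} {n : ℕ} {μ : Fin (n + 1) → ℕ}
    {V : Fin (n + 1) → Submodule ℂ E} {H' : Submodule ℂ E} :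
    (Fin.snoc V H' : Fin (n + 2) → Submodule ℂ E) ∈ flags x H μ ↔
      H' = H ∧ V ∈ flags x (V (Fin.last n)) (Fin.init μ) ∧ V (Fin.last n) ≤ H ∧
        finrank ℂ H = finrank ℂ (V (Fin.last n)) + μ (Fin.last n) ∧
        H.map x ≤ V (Fin.last n) := by
  have hs (i : Fin (n + 1)) : (Fin.snoc V H' : Fin (n + 2) → Submodule ℂ E) i.castSucc = V i :=
    Fin.snoc_castSucc (α := fun _ => Submodule ℂ E) H' V i
  have hl : (Fin.snoc V H' : Fin (n + 2) → Submodule ℂ E) (Fin.last (n + 1)) = H' :=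
    Fin.snoc_last (α := fun _ => Submodule ℂ E) H' V
  rw [mem_flags, mem_flags, Fin.forall_fin_succ', ← Fin.castSucc_zero, hs, hl, Fin.succ_last, hl,
    hs]
  have hi (i : Fin n) : (Fin.snoc V H' : Fin (n + 2) → Submodule ℂ E) i.castSucc.succ = V i.succ :=
    hs i.succ
  constructor
  · rintro ⟨h1, rfl, h2, h3⟩
    refine ⟨rfl, ⟨h1, rfl, fun i => ?_⟩, h3⟩
    have := h2 i
    rwa [hi, hs] at this
  · rintro ⟨rfl, ⟨h1, -, h2⟩, h3⟩
    refine ⟨h1, rfl, fun i => ?_, h3⟩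
    rw [hi, hs]
    exact h2 i

/-- The numerical condition for the existence of flags of type `μ` in `H`. -/
def Admissible (x : Module.End ℂ E) (H : Submodule ℂ E) {n : ℕ} (μ : Fin n → ℕ) : Prop :=
  ∀ S : Finset (Fin n), ∑ i ∈ S, μ i ≤ finrank ℂ (LinearMap.ker (x ^ S.card) ⊓ H : Submodule ℂ E)

variable [FiniteDimensional ℂ E]

theorem isCompact_flags (x : Module.End ℂ E) (H : Submodule ℂ E) {n : ℕ} (μ : Fin n → ℕ) :
    IsCompact (flags x H μ) := by
  apply IsClosed.isCompact
  have : flags x H μ = {V | V 0 = ⊥} ∩ ({V | V (Fin.last n) = H} ∩ ⋂ i : Fin n,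
      ({V | V i.castSucc ≤ V i.succ} ∩
        ({V | finrank ℂ (V i.succ) = finrank ℂ (V i.castSucc) + μ i} ∩
          {V | (V i.succ).map x ≤ V i.castSucc}))) := by
    ext V
    simp only [mem_flags, mem_inter_iff, mem_iInter, mem_ofPred_eq]
  rw [this]
  refine (isClosed_eq (continuous_apply _) continuous_const).inter
    ((isClosed_eq (continuous_apply _) continuous_const).inter (isClosed_iInter fun i => ?_))
  exact (isClosed_setOf_le (continuous_apply _) (continuous_apply _)).inter
    ((isClosed_setOf_finrank_eq (continuous_apply _) (continuous_apply _) _).inter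
      (isClosed_setOf_map_le x (continuous_apply _) (continuous_apply _)))

end Flags

theorem exists_finset_map_castSucc {n : ℕ} (S : Finset (Fin (n + 1))) :
    ∃ T : Finset (Fin n), S = T.map Fin.castSuccEmb ∨
      S = insert (Fin.last n) (T.map Fin.castSuccEmb) := by
  refine ⟨Finset.univ.filter fun i => i.castSucc ∈ S, ?_⟩
  by_cases h : Fin.last n ∈ S
  · refine Or.inr ?_
    ext i
    induction i using Fin.lastCases <;> simp [h]
  · refine Or.inl ?_
    ext i
    induction i using Fin.lastCases <;> simp [h]

section Flags

variable {E : Type*} [NormedAddCommGroup E] [InnerProductSpace ℂ E]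

theorem admissible_succ_iff {x : Module.End ℂ E} {H : Submodule ℂ E} {n : ℕ}
    {μ : Fin (n + 1) → ℕ} : Admissible x H μ ↔ ∀ T : Finset (Fin n),
      ∑ i ∈ T, Fin.init μ i ≤ finrank ℂ (LinearMap.ker (x ^ T.card) ⊓ H : Submodule ℂ E) ∧
      ∑ i ∈ T, Fin.init μ i + μ (Fin.last n) ≤
        finrank ℂ (LinearMap.ker (x ^ (T.card + 1)) ⊓ H : Submodule ℂ E) := by
  have h1 (T : Finset (Fin n)) :
      ∑ i ∈ T.map Fin.castSuccEmb, μ i = ∑ i ∈ T, Fin.init μ i := Finset.sum_map _ _ _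
  have h2 (T : Finset (Fin n)) : ∑ i ∈ insert (Fin.last n) (T.map Fin.castSuccEmb), μ i =
      ∑ i ∈ T, Fin.init μ i + μ (Fin.last n) := by
    rw [Finset.sum_insert (by simp), h1, add_comm]
  have h3 (T : Finset (Fin n)) :
      (insert (Fin.last n) (T.map Fin.castSuccEmb)).card = T.card + 1 := by
    rw [Finset.card_insert_of_notMem (by simp), Finset.card_map]
  constructor
  · intro h T
    have h4 := h (T.map Fin.castSuccEmb)
    have h5 := h (insert (Fin.last n) (T.map Fin.castSuccEmb))
    rw [h1, Finset.card_map] at h4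
    rw [h2, h3] at h5
    exact ⟨h4, h5⟩
  · intro h S
    obtain ⟨T, rfl | rfl⟩ := exists_finset_map_castSucc S
    · rw [h1, Finset.card_map]
      exact (h T).1
    · rw [h2, h3]
      exact (h T).2

variable [FiniteDimensional ℂ E]

/-- Both `ker x^k ⊓ H'` and `xH` lie in `H'`, so their sum has dimension at most `dim H'`. Their
intersection and `xH` are measured by rank-nullity for `x` on `ker x^(k+1) ⊓ H` and on `H`. -/
theorem finrank_ker_pow_inf_le {x : Module.End ℂ E} {H H' : Submodule ℂ E} (k : ℕ)
    (h : H' ≤ H) (hx : H.map x ≤ H') :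
    finrank ℂ (LinearMap.ker (x ^ k) ⊓ H' : Submodule ℂ E) + finrank ℂ H ≤
      finrank ℂ (LinearMap.ker (x ^ (k + 1)) ⊓ H : Submodule ℂ E) + finrank ℂ H' := by
  have h1 := finrank_ker_pow_inf_inf_map k (hx.trans h)
  have h2 := finrank_map_add_finrank_ker_inf x H
  have h3 := Submodule.finrank_sup_add_finrank_inf_eq (LinearMap.ker (x ^ k) ⊓ H') (H.map x)
  have h4 := Submodule.finrank_mono (sup_le (inf_le_right : LinearMap.ker (x ^ k) ⊓ H' ≤ H') hx)
  have h5 := Submodule.finrank_mono (inf_le_inf_right (H.map x)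
    (inf_le_inf_left (LinearMap.ker (x ^ k)) h))
  omega

theorem Admissible.of_nonempty_flags {x : Module.End ℂ E} {n : ℕ} {μ : Fin n → ℕ}
    {H : Submodule ℂ E} (h : (flags x H μ).Nonempty) : Admissible x H μ := by
  induction n generalizing H with
  | zero => intro S; simp [Finset.eq_empty_of_isEmpty S]
  | succ n ih =>
    obtain ⟨V, hV⟩ := h
    rw [← Fin.snoc_init_self V, snoc_mem_flags] at hV
    obtain ⟨-, hV, hle, hdim, hx⟩ := hV
    have hadm := ih ⟨_, hV⟩
    set H' := Fin.init V (Fin.last n)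
    refine admissible_succ_iff.2 fun T => ?_
    have h1 := hadm T
    have h2 := finrank_ker_pow_inf_le T.card hle hx
    exact ⟨h1.trans (Submodule.finrank_mono (inf_le_inf_left _ hle)), by omega⟩

theorem setOf_admissible_eq_schubert {x : Module.End ℂ E} {H : Submodule ℂ E} (m : ℕ) {n : ℕ}
    (μ : Fin n → ℕ) :
    {V : Submodule ℂ E | H.map x ≤ V ∧ V ≤ H ∧ finrank ℂ V = m ∧ Admissible x V μ} =
      schubert (H.map x) H m
        (fun S : Finset (Fin n) => LinearMap.ker (x ^ S.card) ⊓ H ⊔ H.map x)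
        (fun S => ∑ i ∈ S, μ i + finrank ℂ (H.map x) -
          finrank ℂ (LinearMap.ker (x ^ S.card) ⊓ H ⊓ H.map x : Submodule ℂ E)) := by
  ext V
  rw [mem_schubert, mem_ofPred_eq]
  refine and_congr_right fun hL => and_congr_right fun hH => and_congr_right fun _ =>
    forall_congr' fun S => ?_
  have h := finrank_inf_sup_add_finrank_inf (F := LinearMap.ker (x ^ S.card) ⊓ H) hL
  rw [inf_left_comm, inf_eq_left.2 hH] at h
  -- The truncated subtraction is harmless: in `ℕ`, `p - q ≤ r` is equivalent to `p ≤ r + q`.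
  omega

theorem isConnected_setOf_admissible {x : Module.End ℂ E} {H : Submodule ℂ E} {n : ℕ}
    {μ : Fin (n + 1) → ℕ} (hH : H.map x ≤ H) (hadm : Admissible x H μ) {m : ℕ}
    (hm : finrank ℂ H = m + μ (Fin.last n)) (hsum : finrank ℂ H = ∑ i, μ i) :
    IsConnected {V : Submodule ℂ E | H.map x ≤ V ∧ V ≤ H ∧ finrank ℂ V = m ∧
      Admissible x V (Fin.init μ)} := by
  set G : ℕ → Submodule ℂ E := fun k => LinearMap.ker (x ^ k) ⊓ H ⊔ H.map x
  have hG : Monotone G := fun j k hjk => by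
    refine sup_le_sup_right (inf_le_inf_right _ ?_) _
    rw [← Nat.sub_add_cancel hjk, pow_add]
    exact LinearMap.ker_le_ker_comp (x ^ j) (x ^ (k - j))
  have hG0 : G 0 = H.map x := by
    have : LinearMap.ker (x ^ 0) = ⊥ := LinearMap.ker_id
    simp only [G, this, bot_inf_eq, bot_sup_eq]
  have hGle : ∀ k, G k ≤ H := fun k => sup_le inf_le_right hH
  -- Admissibility for the full index set forces `x^(n+1)` to vanish on `H`.
  have hGH : G (n + 1) = H := by
    refine le_antisymm (hGle _) (le_trans ?_ le_sup_left)
    refine (Submodule.eq_of_le_of_finrank_le inf_le_right ?_).ge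
    have := hadm Finset.univ
    rw [Finset.card_univ, Fintype.card_fin] at this
    omega
  have hL := finrank_map_add_finrank_ker_inf x H
  -- Equivalently `dim xH ≤ m`, so `m` lies in the range of dimensions of the chain.
  have h1 : μ (Fin.last n) ≤ finrank ℂ (LinearMap.ker x ⊓ H : Submodule ℂ E) := by
    have := (admissible_succ_iff.1 hadm ∅).2
    rw [Finset.sum_empty, Finset.card_empty, zero_add, zero_add, pow_one] at this
    exact this
  obtain ⟨V₀, hV₀L, hV₀H, hV₀m, hV₀⟩ := exists_finrank_eq_comparable hG (m := m) (K := n + 1)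
    (by rw [hG0]; omega) (by rw [hGH]; omega)
  rw [hG0] at hV₀L
  rw [hGH] at hV₀H
  have hmem : V₀ ∈ {V : Submodule ℂ E | H.map x ≤ V ∧ V ≤ H ∧ finrank ℂ V = m ∧
      Admissible x V (Fin.init μ)} := by
    refine ⟨hV₀L, hV₀H, hV₀m, fun S => ?_⟩
    obtain ⟨h1, h2⟩ := admissible_succ_iff.1 hadm S
    -- If `G k ≤ V₀`, the inequality for `S` suffices. If `V₀ ≤ G k`, the dimension of `ker x^k ⊓
    -- V₀` is exactly `dim (ker x^(k+1) ⊓ H) - μ (Fin.last n)`, and the inequality for `S` with the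
    -- last index adjoined applies.
    rcases hV₀ S.card with h | h
    · exact h1.trans (Submodule.finrank_mono (le_inf inf_le_left (le_sup_left.trans h)))
    · have h3 := finrank_inf_sup_add_finrank_inf (F := LinearMap.ker (x ^ S.card) ⊓ H) hV₀L
      rw [inf_left_comm, inf_eq_left.2 hV₀H] at h3
      have h4 : finrank ℂ (V₀ ⊓ (LinearMap.ker (x ^ S.card) ⊓ H ⊔ H.map x) : Submodule ℂ E) = m := by
        rw [inf_eq_left.2 h, hV₀m]
      have h5 := finrank_ker_pow_inf_inf_map S.card hH
      omega
  rw [setOf_admissible_eq_schubert] at hmem ⊢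
  exact isConnected_schubert hmem fun S => hV₀ S.card

theorem isConnected_flags {x : Module.End ℂ E} {n : ℕ} {μ : Fin n → ℕ} {H : Submodule ℂ E}
    (hH : H.map x ≤ H) (hsum : finrank ℂ H = ∑ i, μ i) (hadm : Admissible x H μ) :
    IsConnected (flags x H μ) := by
  induction n generalizing H with
  | zero =>
    have h0 : H = ⊥ := by
      rw [← Submodule.finrank_eq_zero (R := ℂ), hsum]
      simp
    have : flags x H μ = {fun _ => ⊥} := by
      ext V
      rw [mem_flags, mem_singleton_iff, funext_iff]
      simp [h0, Fin.forall_fin_one]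
    rw [this]
    exact isConnected_singleton
  | succ n ih =>
    rw [Fin.sum_univ_castSucc] at hsum
    set m := ∑ i : Fin n, μ i.castSucc
    have hY := isConnected_setOf_admissible hH hadm hsum (by rw [hsum, Fin.sum_univ_castSucc])
    set Y := {V : Submodule ℂ E | H.map x ≤ V ∧ V ≤ H ∧ finrank ℂ V = m ∧
      Admissible x V (Fin.init μ)}
    let f : (Fin (n + 2) → Submodule ℂ E) → Submodule ℂ E := fun V => V (Fin.last n).castSucc
    have hfib : ∀ W ∈ Y, IsConnected (flags x H μ ∩ f ⁻¹' {W}) := by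
      rintro W ⟨hLW, hWH, hWm, hW⟩
      have hc := ih ((Submodule.map_mono hWH).trans hLW) hWm hW
      have : flags x H μ ∩ f ⁻¹' {W} =
          (fun V => (Fin.snoc V H : Fin (n + 2) → Submodule ℂ E)) '' flags x W (Fin.init μ) := by
        ext V
        constructor
        · rintro ⟨hV, rfl⟩
          have hV' := hV
          rw [← Fin.snoc_init_self V, snoc_mem_flags] at hV'
          refine ⟨Fin.init V, hV'.2.1, ?_⟩
          change Fin.snoc (Fin.init V) H = V
          rw [← hV'.1, Fin.snoc_init_self]
        · rintro ⟨V, hV, rfl⟩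
          have hVW : V (Fin.last n) = W := hV.2.1
          refine ⟨snoc_mem_flags.2 ⟨rfl, hVW ▸ hV, ?_⟩, ?_⟩
          · rw [hVW]
            exact ⟨hWH, by rw [hsum, hWm], hLW⟩
          · simp [f, hVW]
      rw [this]
      refine hc.image _ (Continuous.continuousOn ?_)
      exact Continuous.finSnoc continuous_id continuous_const
    -- One inclusion is necessity of admissibility; the other holds because the fibres over `Y` are
    -- non-empty by induction.
    have himg : f '' flags x H μ = Y := by
      ext W
      constructor
      · rintro ⟨V, hV, rfl⟩
        rw [← Fin.snoc_init_self V, snoc_mem_flags] at hV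
        obtain ⟨-, hV, hle, hdim, hx⟩ := hV
        exact ⟨hx, hle, Nat.add_right_cancel (hdim.symm.trans hsum),
          Admissible.of_nonempty_flags ⟨_, hV⟩⟩
      · intro hW
        obtain ⟨V, hV, hVW⟩ := (hfib W hW).nonempty
        exact ⟨V, hV, hVW⟩
    refine ⟨(himg ▸ hY.nonempty : (f '' flags x H μ).Nonempty).of_image, ?_⟩
    refine isPreconnected_of_fibers (continuous_apply _ : Continuous f) (isCompact_flags x H μ)
      (himg ▸ hY.isPreconnected) fun W hW => (hfib W (himg ▸ hW)).isPreconnected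

theorem nonempty_flags_iff {x : Module.End ℂ E} {n : ℕ} {μ : Fin n → ℕ} {H : Submodule ℂ E}
    (hH : H.map x ≤ H) (hsum : finrank ℂ H = ∑ i, μ i) :
    (flags x H μ).Nonempty ↔ Admissible x H μ :=
  ⟨Admissible.of_nonempty_flags, fun h => (isConnected_flags hH hsum h).nonempty⟩

end Flags

/-! ### Kernel dimensions from the Jordan type. -/

section JordanType

variable {E : Type*} [AddCommGroup E] [Module ℂ E] {x : Module.End ℂ E} {ν : YoungDiagram}
  {b : Basis ν.cells ℂ E}

theorem pow_apply_basis_shift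
    (hb : ∀ c c' : ν.cells, c'.1.1 = c.1.1 → c.1.2 = c'.1.2 + 1 → x (b c) = b c') (k : ℕ)
    (c c' : ν.cells) (h1 : c'.1.1 = c.1.1) (h2 : c.1.2 = c'.1.2 + k) : (x ^ k) (b c) = b c' := by
  induction k generalizing c with
  | zero =>
    rw [Subtype.ext (Prod.ext h1.symm h2) (a1 := c), pow_zero, Module.End.one_apply]
  | succ k ih =>
    obtain ⟨⟨i, j⟩, hc⟩ := c
    simp only at h1 h2
    subst h2
    have hc' : (i, c'.1.2 + k) ∈ ν.cells :=
      ν.isLowerSet (Prod.mk_le_mk.2 ⟨le_rfl, by omega⟩) hc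
    rw [pow_succ, Module.End.mul_apply, hb ⟨_, hc⟩ ⟨_, hc'⟩ rfl rfl, ih ⟨_, hc'⟩ h1 rfl]

theorem pow_apply_basis_eq_zero (h0 : ∀ c : ν.cells, c.1.2 = 0 → x (b c) = 0)
    (hb : ∀ c c' : ν.cells, c'.1.1 = c.1.1 → c.1.2 = c'.1.2 + 1 → x (b c) = b c') {k : ℕ}
    {c : ν.cells} (hc : c.1.2 < k) : (x ^ k) (b c) = 0 := by
  have hc' : (c.1.1, 0) ∈ ν.cells := ν.isLowerSet (Prod.mk_le_mk.2 ⟨le_rfl, Nat.zero_le _⟩) c.2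
  obtain ⟨j, rfl⟩ : ∃ j, k = j + (1 + c.1.2) := ⟨k - (1 + c.1.2), by omega⟩
  rw [pow_add, pow_add, Module.End.mul_apply, Module.End.mul_apply,
    pow_apply_basis_shift hb c.1.2 c ⟨_, hc'⟩ rfl (by simp), pow_one, h0 _ rfl, map_zero]

/-- Boxes in the first `k` columns give independent vectors in the kernel; the others, shifted `k`
places, give independent vectors in the range. These two lower bounds add up to the full dimension,
so both are sharp. -/
theorem HasJordanType.finrank_ker_pow (hx : HasJordanType x ν) (k : ℕ) :
    finrank ℂ (LinearMap.ker (x ^ k)) = (ν.cells.filter fun c => c.2 < k).card := by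
  obtain ⟨b, h0, hb⟩ := hx
  have : FiniteDimensional ℂ E := b.finiteDimensional_of_finite
  have hker : Fintype.card {c : ν.cells // c.1.2 < k} ≤ finrank ℂ (LinearMap.ker (x ^ k)) := by
    rw [← finrank_span_eq_card (b.linearIndependent.comp _ Subtype.val_injective)]
    refine Submodule.finrank_mono (Submodule.span_le.2 ?_)
    rintro _ ⟨c, rfl⟩
    exact pow_apply_basis_eq_zero h0 hb c.2
  have hshift : ∀ c : {c : ν.cells // ¬ c.1.2 < k}, (c.1.1.1, c.1.1.2 - k) ∈ ν.cells := fun c =>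
    ν.isLowerSet (Prod.mk_le_mk.2 ⟨le_rfl, Nat.sub_le _ _⟩) c.1.2
  have hrange : Fintype.card {c : ν.cells // ¬ c.1.2 < k} ≤
      finrank ℂ (LinearMap.range (x ^ k)) := by
    have hinj : Function.Injective
        fun c : {c : ν.cells // ¬ c.1.2 < k} => (⟨_, hshift c⟩ : ν.cells) := by
      intro c c' h
      have h' := congrArg Subtype.val h
      simp only [Prod.mk.injEq] at h'
      have h1 := c.2
      have h2 := c'.2
      exact Subtype.ext (Subtype.ext (Prod.ext h'.1 (by omega)))
    rw [← finrank_span_eq_card (b.linearIndependent.comp _ hinj)]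
    refine Submodule.finrank_mono (Submodule.span_le.2 ?_)
    rintro _ ⟨c, rfl⟩
    have := c.2
    exact ⟨b c.1, pow_apply_basis_shift hb k _ _ rfl (by simp only; omega)⟩
  have h1 := (x ^ k).finrank_range_add_finrank_ker
  rw [finrank_eq_card_basis b] at h1
  have h2 := Fintype.card_subtype_compl (fun c : ν.cells => c.1.2 < k)
  have h3 := Fintype.card_subtype_le (fun c : ν.cells => c.1.2 < k)
  have h4 : (ν.cells.filter fun c => c.2 < k).card = Fintype.card {c : ν.cells // c.1.2 < k} := by
    rw [Fintype.card_subtype, ← Finset.card_map (Function.Embedding.subtype _)]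
    congr 1
    ext c
    simp [and_comm]
  omega

end JordanType

theorem card_filter_cells_transpose {n : ℕ} {lam : Fin n → ℕ} (hlam : Antitone lam) (k : ℕ) :
    ((youngDiagram lam hlam).transpose.cells.filter fun c => c.2 < k).card =
      ∑ i with i.val < k, lam i := by
  have h : ∀ i : Fin n, lam i = (Finset.range (lam i)).card := fun i => (Finset.card_range _).symm
  rw [Finset.sum_congr rfl fun i _ => h i, ← Finset.card_sigma]
  symm
  refine Finset.card_bij (fun p _ => (p.2, p.1.val)) ?_ ?_ ?_
  · rintro ⟨i, j⟩ hij
    simp only [Finset.mem_sigma, Finset.mem_filter, Finset.mem_univ, true_and,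
      Finset.mem_range] at hij
    simp [youngDiagram, YoungDiagram.mem_ofRowLens, hij]
  · rintro ⟨i, j⟩ - ⟨i', j'⟩ - h
    simp only [Prod.mk.injEq] at h
    obtain ⟨rfl, h⟩ := h
    rw [Fin.ext h]
  · rintro ⟨j, i⟩ h
    simp only [youngDiagram, Finset.mem_filter, YoungDiagram.mem_cells,
      YoungDiagram.mem_transpose, YoungDiagram.mem_ofRowLens, Prod.swap_prod_mk,
      List.length_ofFn, List.getElem_ofFn] at h
    obtain ⟨⟨hi, hj⟩, hk⟩ := h
    exact ⟨⟨⟨i, hi⟩, j⟩, by simp [hj, hk], rfl⟩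

/-! ### Dominance as a condition on all subsets. -/

section Dominance

variable {n : ℕ}

/-- Exchange argument: `S \ T` and `T \ S` have equal size, and the minimum `c` of `f` on `T \ S`
bounds `f` from above on `S \ T`. -/
theorem sum_le_sum_filter_lt_card {f : Fin n → ℕ} (hf : Antitone f) (S : Finset (Fin n)) :
    ∑ i ∈ S, f i ≤ ∑ i with i.val < S.card, f i := by
  set T : Finset (Fin n) := Finset.univ.filter fun i => i.val < S.card
  have hle : S.card ≤ n := by simpa using S.card_le_univ
  have hT : T.card = S.card := by
    simp [T, Fin.card_filter_val_lt, hle]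
  have hcard : (S \ T).card = (T \ S).card := by
    have h1 := Finset.card_sdiff_add_card_inter S T
    have h2 := Finset.card_sdiff_add_card_inter T S
    rw [Finset.inter_comm] at h2
    omega
  rw [← Finset.sum_sdiff_le_sum_sdiff]
  rcases (S \ T).eq_empty_or_nonempty with h | ⟨i₀, hi₀⟩
  · rw [h, Finset.sum_empty]
    exact Nat.zero_le _
  set c := (T \ S).inf' (Finset.card_pos.1 (hcard ▸ Finset.card_pos.2 ⟨i₀, hi₀⟩)) f
  calc ∑ i ∈ S \ T, f i ≤ (S \ T).card • c := by
        refine Finset.sum_le_card_nsmul _ _ _ fun i hi => Finset.le_inf' _ _ fun j hj => hf ?_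
        have h1 := (Finset.mem_sdiff.1 hi).2
        have h2 := (Finset.mem_sdiff.1 hj).1
        simp only [T, Finset.mem_filter, Finset.mem_univ, true_and] at h1 h2
        exact Fin.le_def.2 (by omega)
    _ = (T \ S).card • c := by rw [hcard]
    _ ≤ ∑ i ∈ T \ S, f i := Finset.card_nsmul_le_sum _ _ _ fun i hi => Finset.inf'_le _ hi

theorem antitone_sortDesc (μ : Fin n → ℕ) : Antitone (sortDesc μ) := fun _ _ h =>
  Tuple.monotone_sort μ (Fin.rev_le_rev.2 h)

theorem dominates_sortDesc_iff {lam μ : Fin n → ℕ} : Dominates lam (sortDesc μ) ↔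
    ∀ S : Finset (Fin n), ∑ i ∈ S, μ i ≤ ∑ i with i.val < S.card, lam i := by
  let σ : Equiv.Perm (Fin n) := Fin.revPerm.trans (Tuple.sort μ)
  have hσ : ∀ i, sortDesc μ i = μ (σ i) := fun _ => rfl
  have hIic : ∀ k : Fin n, Finset.Iic k = Finset.univ.filter fun i : Fin n => i.val < k.val + 1 := by
    intro k
    ext i
    rw [Finset.mem_Iic, Finset.mem_filter, Fin.le_def]
    simp only [Finset.mem_univ, true_and]
    omega
  constructor
  · intro h S
    rcases S.eq_empty_or_nonempty with rfl | hS
    · simp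
    have hpos := Finset.card_pos.2 hS
    have hle : S.card ≤ n := by simpa using S.card_le_univ
    -- `Finset.Iic k` has `k + 1` elements, hence the shift by one.
    have h1 := h ⟨S.card - 1, by omega⟩
    rw [hIic] at h1
    simp only [Nat.sub_add_cancel hpos] at h1
    have h2 := sum_le_sum_filter_lt_card (antitone_sortDesc μ) (S.map σ.symm.toEmbedding)
    rw [Finset.card_map] at h2
    refine le_trans (le_of_eq ?_) (h2.trans h1)
    simp [Finset.sum_map, hσ]
  · intro h k
    have h1 := h ((Finset.Iic k).map σ.toEmbedding)
    rw [Finset.card_map, Fin.card_Iic, ← hIic, Finset.sum_map] at h1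
    exact h1

end Dominance

/-! ### Transfer to the Spaltenstein variety. -/

theorem admissible_top_iff_dominates {E : Type*} [NormedAddCommGroup E] [InnerProductSpace ℂ E]
    {n : ℕ} {lam μ : Fin n → ℕ} {hlam : Antitone lam} {x : Module.End ℂ E}
    (hx : HasJordanType x (youngDiagram lam hlam).transpose) :
    Admissible x ⊤ μ ↔ Dominates lam (sortDesc μ) := by
  rw [dominates_sortDesc_iff]
  refine forall_congr' fun S => ?_
  rw [inf_top_eq, hx.finrank_ker_pow, card_filter_cells_transpose]

theorem isInducing_partialFlag {d n : ℕ} (μ : Fin n → ℕ) :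
    IsInducing (PartialFlag.V : PartialFlag d μ → _) := by
  have h : IsInducing fun (V : Fin (n + 1) → Submodule ℂ (EuclideanSpace ℂ (Fin d))) i =>
      (V i).starProjection := IsInducing.piMap fun _ => isInducing_starProjection
  exact (IsInducing.of_comp_iff h).1 ⟨rfl⟩

theorem image_spaltensteinVariety {d n : ℕ} (x : Module.End ℂ (EuclideanSpace ℂ (Fin d)))
    (μ : Fin n → ℕ) : PartialFlag.V '' spaltensteinVariety x μ = flags x ⊤ μ := by
  have key {A B : Submodule ℂ (EuclideanSpace ℂ (Fin d))} (h : A ≤ B) :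
      finrank ℂ (B ⧸ A.submoduleOf B) + finrank ℂ A = finrank ℂ B := by
    rw [← (Submodule.submoduleOfEquivOfLe h).finrank_eq, Submodule.finrank_quotient_add_finrank]
  ext V
  constructor
  · rintro ⟨F, hF, rfl⟩
    refine ⟨F.zero, F.last, fun i => ⟨F.le_succ i, ?_, hF i⟩⟩
    rw [← key (F.le_succ i), F.finrank_quotient i, add_comm]
  · rintro ⟨h0, hl, h⟩
    refine ⟨⟨V, h0, hl, fun i => (h i).1, fun i => ?_⟩, fun i => (h i).2.2, rfl⟩
    have := key (h i).1
    have := (h i).2.1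
    omega

end Spaltenstein

/-- For `lam` an `n`-part partition of `d`, `μ` an `n`-part composition of `d` and `x` a nilpotent
endomorphism of `ℂ^d` whose Jordan type is the transpose of `lam`. -/
theorem corollary2p5 (n d : ℕ) (lam μ : Fin n → ℕ) (hlam : Antitone lam)
    (hlam_sum : ∑ i, lam i = d) (hμ_sum : ∑ i, μ i = d)
    (x : Module.End ℂ (EuclideanSpace ℂ (Fin d)))
    (hx : Spaltenstein.HasJordanType x (Spaltenstein.youngDiagram lam hlam).transpose) :
    ((Spaltenstein.spaltensteinVariety x μ).Nonempty ↔
      Spaltenstein.Dominates lam (Spaltenstein.sortDesc μ)) ∧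
    (Spaltenstein.Dominates lam (Spaltenstein.sortDesc μ) →
      IsConnected (Spaltenstein.spaltensteinVariety x μ)) := by
  have hdim : Module.finrank ℂ (⊤ : Submodule ℂ (EuclideanSpace ℂ (Fin d))) = ∑ i, μ i := by
    rw [finrank_top, finrank_euclideanSpace_fin, hμ_sum]
  have hne : (Spaltenstein.spaltensteinVariety x μ).Nonempty ↔
      Spaltenstein.Dominates lam (Spaltenstein.sortDesc μ) := by
    rw [← Set.image_nonempty (f := Spaltenstein.PartialFlag.V),
      Spaltenstein.image_spaltensteinVariety, Spaltenstein.nonempty_flags_iff le_top hdim,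
      Spaltenstein.admissible_top_iff_dominates hx]
  refine ⟨hne, fun h => ⟨hne.2 h, ?_⟩⟩
  rw [← (Spaltenstein.isInducing_partialFlag μ).isPreconnected_image,
    Spaltenstein.image_spaltensteinVariety]
  exact (Spaltenstein.isConnected_flags le_top hdim
    ((Spaltenstein.admissible_top_iff_dominates hx).2 h)).isPreconnected
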